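/- **Setting.** A network $\mathcal N=(\mathcal V,\mathcal L,\mathcal I,D)$ consists of a finite acyclic directed multigraph with node set $\mathcal V$ and link set $\mathcal L$, a collision set $\mathcal I(l)\subseteq\mathcal L$ for each link $l$, and a link-wise delay matrix $D:\mathcal L^2\to\mathbb Z$. A schedule is a map $S:\mathcal L\times\mathbb N\to\{0,1\}$. It is collision free if $S(l,t)=S(l',t+D(l,l'))=1$ never holds with $l'\in\mathcal I(l)$ and $t,\,t+D(l,l')\in\mathbb N$. Its rate vector, if the limits exist, is $R_S(l)=\lim_{n\to\infty}\frac1n\sum_{t<n}S(l,t)$. The scheduling rate region $\mathcal R$ is the set of all $R\in\mathbb R_{\ge0}^{\mathcal L}$ such that for every $\epsilon>0$ there is a collision-free schedule $S$ that has a rate vector and satisfies $R_S(l)>R(l)-\epsilon$ for all $l$. There are $k\ge1$ distinct sources $s_1,\dots,s_k\in\mathcal V$, and $s_i$ has a nonempty finite set of sinks $t_{i,1},\dots,t_{i,k_i}\in\mathcal V$. For $\tilde{\mathcal R}\subseteq\mathbb R^{\mathcal L}$, the program LP-MMF$(\tilde{\mathcal R})$ maximizes $\sum_i v_i$ over real variables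 $F_{i,j}(l),G_i(l),v_i$ and $R\in\tilde{\mathcal R}$ subject to: $F_{i,j}\ge0$; $\sum_{l\in\mathrm{In}(u)}F_{i,j}(l)=\sum_{l\in\mathrm{Out}(u)}F_{i,j}(l)$ for every node $u\ne s_i,t_{i,j}$; $\sum_{l\in\mathrm{Out}(s_i)}F_{i,j}(l)=\sum_{l\in\mathrm{In}(t_{i,j})}F_{i,j}(l)=v_i$; $F_{i,j}(l)\le G_i(l)$; and the capacity constraint $$\textstyle\sum_{i=1}^k G_i(l)\le R(l)\quad(l\in\mathcal L),\qquad(*)$$ which implies $F_{i,j}(l)\le R(l)$. LP-MCMF$(\tilde{\mathcal R})$ maximizes $\phi$ subject to the same constraints with $v_i=\phi\gamma_i$ for all $i$, where the desired traffic rates $\gamma_i\ge0$ are given and not all zero. The maximum multiflow (maximum concurrent multiflow) of the network is the optimal value of LP-MMF$(\mathcal R)$ (of LP-MCMF$(\mathcal R)$). A dual vector of the program over $\tilde{\mathcal R}$ is an optimal Lagrange multiplier of $(*)$: a vector $\mu\in\mathbb R_{\ge0}^{\mathcal L}$ such that, when $(*)$ is dropped, the objective value plus $\sum_l\mu(l)\bigl(R(l)-\sum_iG_i(l)\bigr)$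 never exceeds the optimal value of the program. Let $T\ge1$ be an integer with $T\ge|D(l,l')|$ for all $l\in\mathcal L$, $l'\in\mathcal I(l)$. For a schedule $S$ let $S[T,j]$ be the submatrix of columns $jT,\dots,(j+1)T-1$. The scheduling graph has as vertices the matrices $S[T,0]$ and as edges the pairs $(S[T,0],S[T,1])$, with $S$ collision free. For $a\in\mathbb R^{\mathcal L}$, the weighted scheduling graph gives the edge $(A,B)$ the weight $w_a(A,B)=a^{\intercal}B\mathbf 1$. A cycle is a closed path of length at least $1$ whose only repeated vertices are its first and last; a maximum-mean-cycle is a cycle of maximum average edge weight. **Algorithm.** Start with any $R_1\in\mathcal R$ and $\mathcal R_1=\{R_1\}$. For $i=1,2,\dots$: 1. compute the optimal value $v_i$ of LP-MMF$(\mathcal R_i)$ (or LP-MCMF$(\mathcal R_i)$) and any dual vector $\mu_i$; 2. find any maximum-mean-cycle of the scheduling graph weighted by $w_{\mu_i}$, and let $R_{i+1}$ be the rate vector of the periodic schedule that repeats the concatenation of the matrices on the cycle; 3. if $\langle\mu_i,R_{i+1}\rangle=\max_{R\in\mathcal R_i}\langle\mu_i,R\rangle$, return $v_i$; otherwise put $\mathcal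 R_{i+1}=\mathrm{conv}(\mathcal R_i\cup\{R_{i+1}\})$ and continue. **Theorem (Optimality).** For every such network, sessions, $T$ and $R_1\in\mathcal R$, and for each of the two problems, whatever choices of dual vectors and maximum-mean-cycles are made: every iteration can be carried out, the algorithm terminates after finitely many iterations, and the returned value is exactly the maximum multiflow (respectively, the maximum concurrent multiflow) of the network. -/

import Mathlib

open Filter Topology

namespace Multiflow

/-! ### Networks, schedules and the scheduling rate region -/

/-- An acyclic network with node set `V` and link set `L` (parallel links are allowed).
`l' ∈ N.collision l` says that `l'` is in the interference range of `l`;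
`N.delay` is the link-wise delay matrix. -/
structure Network (V L : Type*) where
  tail : L → V
  head : L → V
  collision : L → Set L
  delay : L → L → ℤ
  acyclic : ∀ v : V, ¬ Relation.TransGen (fun u w => ∃ l, tail l = u ∧ head l = w) v v

/-- A schedule: `S l t` says whether link `l` is active in time slot `t`. -/
abbrev Schedule (L : Type*) := L → ℕ → Bool

variable {V L : Type*}

/-- No active link-slot `(l, t)` meets an active `(l', t + D(l, l'))` with `l'` in the collision
set of `l`; time slots are the natural numbers, so a negative `t + D(l, l')` never collides. -/
def Network.CollisionFree (N : Network V L) (S : Schedule L) : Prop :=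
  ∀ (l l' : L) (t t' : ℕ), l' ∈ N.collision l → (t' : ℤ) = (t : ℤ) + N.delay l l' →
    ¬ (S l t = true ∧ S l' t' = true)

/-- All link rates of `S` exist, and `R` is the rate vector of `S`. -/
def IsRateVector (S : Schedule L) (R : L → ℝ) : Prop :=
  ∀ l, Tendsto (fun n : ℕ => (∑ t ∈ Finset.range n, ((S l t).toNat : ℝ)) / (n : ℝ))
    atTop (𝓝 (R l))

/-- The scheduling rate region: the (nonnegative) achievable rate vectors. -/
def Network.rateRegion (N : Network V L) : Set (L → ℝ) :=
  {R | (∀ l, 0 ≤ R l) ∧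
    ∀ ε : ℝ, 0 < ε → ∃ (S : Schedule L) (Q : L → ℝ),
      N.CollisionFree S ∧ IsRateVector S Q ∧ ∀ l, R l - ε < Q l}

/-! ### Flows and the two linear programs -/

section Flows

variable [Fintype L]

open Classical in
/-- Total flow on the input links of `v`. -/
noncomputable def Network.inFlow (N : Network V L) (F : L → ℝ) (v : V) : ℝ :=
  ∑ l with N.head l = v, F l

open Classical in
/-- Total flow on the output links of `v`. -/
noncomputable def Network.outFlow (N : Network V L) (F : L → ℝ) (v : V) : ℝ :=
  ∑ l with N.tail l = v, F l

/-- A nonnegative flow from `s` to `t`, conserved at every other node. -/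
structure Network.IsFlow (N : Network V L) (s t : V) (F : L → ℝ) : Prop where
  nonneg : ∀ l, 0 ≤ F l
  conservation : ∀ v, v ≠ s → v ≠ t → N.inFlow F v = N.outFlow F v

/-- A valid flow from `s` to `t` with respect to the rate vector `R`. -/
structure Network.IsValidFlow (N : Network V L) (R : L → ℝ) (s t : V) (F : L → ℝ) : Prop
    extends N.IsFlow s t F where
  le_rate : ∀ l, F l ≤ R l

/-- `k ≥ 1` multicast sessions: pairwise distinct sources, each with a nonempty finite set of
sinks. -/
structure Sessions (V : Type*) (k : ℕ) where
  pos : 0 < k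
  source : Fin k → V
  source_injective : Function.Injective source
  sinks : Fin k → Finset V
  sinks_nonempty : ∀ i, (sinks i).Nonempty

variable {k : ℕ}

/-- The two problems: maximise the total rate (maximum multiflow), or the common fraction `φ` of
the desired traffic rates `γ` (maximum concurrent multiflow). -/
inductive Objective (k : ℕ) where
  | total : Objective k
  | concurrent (γ : Fin k → ℝ) : Objective k

/-- The desired traffic rates are nonnegative and not all zero. -/
def Objective.WellPosed : Objective k → Prop
  | .total => True
  | .concurrent γ => (∀ i, 0 ≤ γ i) ∧ ∃ i, 0 < γ i

/-- `z` is an objective value for the session rates `v`: `z = ∑ᵢ vᵢ` for the total rate,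
`vᵢ = z γᵢ` for all `i` in the concurrent problem. -/
def Objective.HasValue : Objective k → (Fin k → ℝ) → ℝ → Prop
  | .total, v, z => z = ∑ i, v i
  | .concurrent γ, v, z => ∀ i, v i = z * γ i

/-- The variables of the linear programs, other than `R` and the objective value:
flows `F i t` for each session `i` and sink `t`, session rates `v i`, and link usages `G i l`. -/
structure FlowVars (L : Type*) (C : Sessions V k) where
  F : (i : Fin k) → {t // t ∈ C.sinks i} → L → ℝ
  v : Fin k → ℝ
  G : Fin k → L → ℝ

/-- The constraints that do not involve the rate vector. -/
structure FlowVars.Routes {C : Sessions V k} (x : FlowVars L C) (N : Network V L) : Prop where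
  isFlow : ∀ i (t : {t // t ∈ C.sinks i}), N.IsFlow (C.source i) t (x.F i t)
  out_source : ∀ i t, N.outFlow (x.F i t) (C.source i) = x.v i
  in_sink : ∀ i t, N.inFlow (x.F i t) (t : V) = x.v i
  le_usage : ∀ i t l, x.F i t l ≤ x.G i l

/-- Total usage `∑ᵢ Gᵢ(l)` of each link. -/
def FlowVars.load {C : Sessions V k} (x : FlowVars L C) (l : L) : ℝ := ∑ i, x.G i l

/-- The objective values of the feasible points of LP-MMF(`P`), respectively LP-MCMF(`P`). -/
def lpValues (N : Network V L) (C : Sessions V k) (obj : Objective k) (P : Set (L → ℝ)) :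
    Set ℝ :=
  {z | ∃ (x : FlowVars L C) (R : L → ℝ), R ∈ P ∧ x.Routes N ∧ obj.HasValue x.v z ∧
    (∀ i (t : {t // t ∈ C.sinks i}), N.IsValidFlow R (C.source i) t (x.F i t)) ∧ (∀ l, x.load l ≤ R l)}

/-- The bounds `F i t l ≤ R l` in the linear programs are implied by the capacity constraint
`load ≤ R`. -/
theorem FlowVars.Routes.isValidFlow {N : Network V L} {C : Sessions V k} {x : FlowVars L C}
    (hx : x.Routes N) {R : L → ℝ} (hR : ∀ l, x.load l ≤ R l) (i : Fin k)
    (t : {t // t ∈ C.sinks i}) : N.IsValidFlow R (C.source i) t (x.F i t) := by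
  refine ⟨hx.isFlow i t, fun l => (hx.le_usage i t l).trans (le_trans ?_ (hR l))⟩
  refine Finset.single_le_sum (f := fun j => x.G j l) (fun j _ => ?_) (Finset.mem_univ i)
  obtain ⟨s, hs⟩ := C.sinks_nonempty j
  exact ((hx.isFlow j ⟨s, hs⟩).nonneg l).trans (hx.le_usage j ⟨s, hs⟩ l)

/-- `μ` is a dual vector (optimal Lagrange multiplier) of the capacity constraint `load ≤ R` in
the linear program over `P`, whose optimal value is `v`: `μ ≥ 0`, and relaxing the capacity
constraint with price `μ` does not allow a value above `v`. The redundant bounds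
`F i t l ≤ R l` are part of the capacity constraint and carry no multipliers of their own. -/
structure IsDualVector (N : Network V L) (C : Sessions V k) (obj : Objective k)
    (P : Set (L → ℝ)) (v : ℝ) (μ : L → ℝ) : Prop where
  nonneg : ∀ l, 0 ≤ μ l
  bound : ∀ (x : FlowVars L C) (R : L → ℝ) (z : ℝ), R ∈ P → x.Routes N → obj.HasValue x.v z →
    z + ∑ l, μ l * (R l - x.load l) ≤ v

end Flows

/-! ### Weighted scheduling graphs and maximum-mean-cycles -/

/-- The matrix `S[T, j]`: columns `jT, …, (j+1)T - 1` of the schedule `S`. -/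
def Schedule.block (S : Schedule L) (T j : ℕ) : L → Fin T → Bool :=
  fun l t => S l (j * T + t)

/-- The vertex set of the scheduling graph. -/
def Network.SchedVertex (N : Network V L) (T : ℕ) : Type _ :=
  {A : L → Fin T → Bool // ∃ S : Schedule L, N.CollisionFree S ∧ S.block T 0 = A}

/-- The scheduling graph. -/
def Network.schedulingGraph (N : Network V L) (T : ℕ) : Digraph (N.SchedVertex T) where
  Adj A B := ∃ S : Schedule L, N.CollisionFree S ∧ S.block T 0 = A.1 ∧ S.block T 1 = B.1

/-- The edge weight `aᵀ B 1` of the weighted scheduling graph. -/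
def Network.weight [Fintype L] (N : Network V L) (T : ℕ) (a : L → ℝ)
    (_A B : N.SchedVertex T) : ℝ :=
  ∑ l, a l * ∑ t : Fin T, ((B.1 l t).toNat : ℝ)

/-- `(c 0, c 1, …, c m)` is a cycle: `m ≥ 1`, consecutive vertices are joined by edges,
`c m = c 0`, and there is no other repetition. The values `c i` with `i > m` play no role. -/
structure IsCycle {α : Type*} (G : Digraph α) (m : ℕ) (c : ℕ → α) : Prop where
  pos : 0 < m
  adj : ∀ i < m, G.Adj (c i) (c (i + 1))
  closed : c m = c 0
  inj : ∀ i < m, ∀ j < m, c i = c j → i = j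

/-- Average edge weight of the cycle `(c 0, …, c m)`. -/
noncomputable def cycleMean {α : Type*} (w : α → α → ℝ) (m : ℕ) (c : ℕ → α) : ℝ :=
  (∑ i ∈ Finset.range m, w (c i) (c (i + 1))) / (m : ℝ)

/-- A cycle of maximum average weight. -/
def IsMaxMeanCycle {α : Type*} (G : Digraph α) (w : α → α → ℝ) (m : ℕ) (c : ℕ → α) : Prop :=
  IsCycle G m c ∧ ∀ (m' : ℕ) (c' : ℕ → α), IsCycle G m' c' → cycleMean w m' c' ≤ cycleMean w m c

/-- The periodic schedule that repeats the concatenation of the matrices `c 0, …, c (m - 1)`. -/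
def periodicSchedule {N : Network V L} {T : ℕ} (hT : 0 < T) (m : ℕ) (c : ℕ → N.SchedVertex T) :
    Schedule L :=
  fun l t => (c (t / T % m)).1 l ⟨t % T, Nat.mod_lt t hT⟩

/-! ### The algorithm -/

/-- A state of the algorithm: either it holds the current polytope of rate vectors, or it has
returned a value. -/
inductive State (L : Type*) where
  | running (P : Set (L → ℝ)) : State L
  | returned (v : ℝ) : State L

section Algorithm

variable [Fintype L] {k : ℕ}

/-- The data computed in one iteration with current polytope `P`: the optimal value `v` of the
linear program over `P`, a dual vector `μ`, and the rate vector `R'` of the periodic schedule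
given by a maximum-mean-cycle of the scheduling graph weighted by `μ`. -/
structure IsIteration (N : Network V L) (C : Sessions V k) (obj : Objective k) {T : ℕ}
    (hT : 0 < T) (P : Set (L → ℝ)) (v : ℝ) (μ R' : L → ℝ) : Prop where
  value : IsGreatest (lpValues N C obj P) v
  dual : IsDualVector N C obj P v μ
  rate : ∃ (m : ℕ) (c : ℕ → N.SchedVertex T),
    IsMaxMeanCycle (N.schedulingGraph T) (N.weight T μ) m c ∧
      IsRateVector (periodicSchedule hT m c) R'

/-- The stopping test `⟨μ, R'⟩ = max_{R ∈ P} ⟨μ, R⟩`. -/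
def StopTest (P : Set (L → ℝ)) (μ R' : L → ℝ) : Prop :=
  IsGreatest ((fun R : L → ℝ => ∑ l, μ l * R l) '' P) (∑ l, μ l * R' l)

/-- One iteration of the algorithm. It is a relation, since the dual vector and the
maximum-mean-cycle need not be unique: any choice is allowed. -/
inductive Step (N : Network V L) (C : Sessions V k) (obj : Objective k) {T : ℕ} (hT : 0 < T) :
    State L → State L → Prop
  | finish (P : Set (L → ℝ)) (v : ℝ) (μ R' : L → ℝ) :
      IsIteration N C obj hT P v μ R' → StopTest P μ R' →
      Step N C obj hT (State.running P) (State.returned v)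
  | next (P : Set (L → ℝ)) (v : ℝ) (μ R' : L → ℝ) :
      IsIteration N C obj hT P v μ R' → ¬ StopTest P μ R' →
      Step N C obj hT (State.running P) (State.running (convexHull ℝ (P ∪ {R'})))

end Algorithm

end Multiflow

open Multiflow

/-! Everything rests on one fact: for `μ ≥ 0`, the rate vector of a maximum-mean-cycle maximises
`⟨μ, ·⟩` over the whole rate region (`IsMaxMeanCycle.sum_mul_le`). The blocks of a collision-free
schedule form an infinite walk in a finite graph. A finite walk splits into cycles and a remainder
of bounded length, so its weight is at most its length times the maximum cycle mean, up to a
constant. The mean of a cycle is `T` times the price of its rate vector.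

Termination follows: if the stopping test fails, the new vector `R'` was not in `P`, since it would
then attain the maximum over `P`. Only finitely many vectors are rates of cycles, and each iteration
that continues absorbs a new one.

Correctness is weak duality: if the test succeeds, the price `⟨μ, ·⟩` has the same maximum over `P`
and over the region, so the bound that `μ` certifies over `P` holds over the region
(`IsDualVector.isGreatest`).

No iteration gets stuck because `P` remains a polytope inside the region: with delays at most `T`,
cycle schedules are collision free, and time sharing makes the region convex. Compactness then gives
an optimal value, Farkas' lemma a dual vector (`exists_isDualVector`), and finiteness a best cycle.
-/

namespace Multiflow

/-! ### Farkas' lemma for finitely many linear functionals -/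

section Farkas

variable {E : Type*} [AddCommGroup E] [Module ℝ E]

/-- Farkas' lemma: a functional that is nonpositive wherever finitely many functionals are
nonpositive is a nonnegative combination of them. -/
theorem exists_nonneg_combination {ι : Type*} (s : Finset ι) (a : ι → E →ₗ[ℝ] ℝ) (c : E →ₗ[ℝ] ℝ)
    (h : ∀ x, (∀ i ∈ s, a i x ≤ 0) → c x ≤ 0) :
    ∃ r : ι → ℝ, (∀ i, 0 ≤ r i) ∧ ∀ x, c x = ∑ i ∈ s, r i * a i x := by
  classical
  induction s using Finset.induction_on generalizing a c with
  | empty =>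
    refine ⟨fun _ => 0, fun _ => le_rfl, fun x => ?_⟩
    have h₁ := h x (by simp)
    have h₂ := h (-x) (by simp)
    rw [map_neg] at h₂
    simp only [Finset.sum_empty]
    linarith
  | insert j s hj ih =>
    by_cases hc : ∀ x, (∀ i ∈ s, a i x ≤ 0) → c x ≤ 0
    · obtain ⟨r, hr, hrc⟩ := ih a c hc
      refine ⟨fun i => if i = j then 0 else r i, fun i => ?_, fun x => ?_⟩
      · dsimp only
        split_ifs
        exacts [le_rfl, hr i]
      · rw [Finset.sum_insert hj, hrc]
        dsimp only
        rw [if_pos rfl, zero_mul, zero_add]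
        refine Finset.sum_congr rfl fun i hi => ?_
        rw [if_neg (ne_of_mem_of_not_mem hi hj)]
    · push Not at hc
      obtain ⟨y, hys, hyc⟩ := hc
      have hyj : 0 < a j y := by
        by_contra! hle
        refine hyc.not_ge (h y fun i hi => ?_)
        rcases Finset.mem_insert.1 hi with rfl | hi
        exacts [hle, hys i hi]
      -- The projection onto the kernel of `a j` along `y`: constraint `j` holds on its range, so
      -- only the constraints in `s` remain for `c.comp p`.
      let p : E →ₗ[ℝ] E := LinearMap.id - (a j).smulRight ((a j y)⁻¹ • y)
      have hp : ∀ (f : E →ₗ[ℝ] ℝ) x, f (p x) = f x - a j x * ((a j y)⁻¹ * f y) := by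
        intro f x
        simp [p]
      obtain ⟨r, hr, hrc⟩ := ih (fun i => (a i).comp p) (c.comp p) fun x hx => by
        refine h (p x) fun i hi => ?_
        rcases Finset.mem_insert.1 hi with rfl | hi
        · rw [hp, inv_mul_cancel₀ hyj.ne', mul_one, sub_self]
        · exact hx i hi
      have hsum : ∑ i ∈ s, r i * a i y ≤ 0 :=
        Finset.sum_nonpos fun i hi => mul_nonpos_of_nonneg_of_nonpos (hr i) (hys i hi)
      -- The coefficient of `a j` is forced by evaluating the identity at `y`; it is nonnegative
      -- since `c y > 0` while the sum at `y` is nonpositive.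
      refine ⟨fun i => if i = j then (a j y)⁻¹ * (c y - ∑ i ∈ s, r i * a i y) else r i,
        fun i => ?_, fun x => ?_⟩
      · dsimp only
        split_ifs
        · exact mul_nonneg (inv_nonneg.2 hyj.le) (by linarith)
        · exact hr i
      · have hx := hrc x
        simp only [LinearMap.comp_apply, hp] at hx
        rw [Finset.sum_insert hj]
        dsimp only
        rw [if_pos rfl]
        have hs : ∑ i ∈ s, (if i = j then (a j y)⁻¹ * (c y - ∑ i ∈ s, r i * a i y) else r i) * a i x
            = ∑ i ∈ s, r i * a i x := Finset.sum_congr rfl fun i hi => by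
          rw [if_neg (ne_of_mem_of_not_mem hi hj)]
        have hx' : ∑ i ∈ s, r i * (a i x - a j x * ((a j y)⁻¹ * a i y))
            = ∑ i ∈ s, r i * a i x - a j x * (a j y)⁻¹ * ∑ i ∈ s, r i * a i y := by
          rw [Finset.mul_sum, ← Finset.sum_sub_distrib]
          exact Finset.sum_congr rfl fun i _ => by ring
        rw [hs]
        linear_combination hx + hx'

/-- Lagrange multipliers for some of the constraints of a homogeneous linear program. -/
theorem exists_lagrange_multiplier {ι κ : Type*} [Fintype ι] [Fintype κ]
    (a : ι → E →ₗ[ℝ] ℝ) (g : κ → E →ₗ[ℝ] ℝ) (c : E →ₗ[ℝ] ℝ)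
    (h : ∀ x, (∀ i, a i x ≤ 0) → (∀ j, g j x ≤ 0) → c x ≤ 0) :
    ∃ μ : κ → ℝ, (∀ j, 0 ≤ μ j) ∧ ∀ x, (∀ i, a i x ≤ 0) → c x ≤ ∑ j, μ j * g j x := by
  obtain ⟨r, hr, hrc⟩ := exists_nonneg_combination (Finset.univ : Finset (ι ⊕ κ)) (Sum.elim a g) c
    fun x hx => h x (fun i => hx (.inl i) (Finset.mem_univ _)) fun j => hx (.inr j) (Finset.mem_univ _)
  refine ⟨fun j => r (.inr j), fun j => hr _, fun x hx => ?_⟩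
  rw [hrc, Fintype.sum_sum_type]
  have : ∑ i, r (.inl i) * a i x ≤ 0 :=
    Finset.sum_nonpos fun i _ => mul_nonpos_of_nonneg_of_nonpos (hr _) (hx i)
  simpa using this

end Farkas

/-! ### Walks and cycles in finite digraphs -/

section Walks

variable {α : Type*} {G : Digraph α} {w : α → α → ℝ}

/-- If no cycle has positive weight, then the weights of walks are bounded. -/
theorem exists_walk_weight_le [Finite α]
    (h : ∀ m c, IsCycle G m c → ∑ i ∈ Finset.range m, w (c i) (c (i + 1)) ≤ 0) :
    ∃ K : ℝ, ∀ (n : ℕ) (c : ℕ → α), (∀ i < n, G.Adj (c i) (c (i + 1))) →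
      ∑ i ∈ Finset.range n, w (c i) (c (i + 1)) ≤ K := by
  classical
  have := Fintype.ofFinite α
  set B : ℝ := ∑ p : α × α, |w p.1 p.2| with hB
  have hB0 : 0 ≤ B := Finset.sum_nonneg fun _ _ => abs_nonneg _
  have hwB : ∀ x y, w x y ≤ B := fun x y => (le_abs_self _).trans
    (Finset.single_le_sum (f := fun p : α × α => |w p.1 p.2|) (fun _ _ => abs_nonneg _)
      (Finset.mem_univ (x, y)))
  -- A walk whose edges start at distinct vertices has at most `Fintype.card α` edges. Any other
  -- walk contains a cycle of nonpositive weight; deleting it shortens the walk without lowering the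
  -- weight.
  refine ⟨Fintype.card α * B, fun n => ?_⟩
  induction n using Nat.strong_induction_on with
  | _ n ih =>
    intro c hc
    by_cases hrep : ∃ d, 0 < d ∧ ∃ i, i + d < n ∧ c i = c (i + d)
    · obtain ⟨hd, i, hin, hi⟩ := Nat.find_spec hrep
      have hmin := fun e (he : e < Nat.find hrep) => Nat.find_min hrep he
      -- Minimality of the gap `d` excludes repetitions inside the closed piece, which is therefore
      -- a cycle.
      generalize Nat.find hrep = d at hd hin hi hmin
      obtain ⟨q, rfl⟩ : ∃ q, n = i + (d + q) := ⟨n - d - i, by omega⟩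
      have hlt : ∀ a b, a < b → b < d → c (i + a) ≠ c (i + b) := fun a b hab hbd hEq =>
        hmin (b - a) (by omega) ⟨by omega, i + a, by omega, by
          rw [hEq, show i + a + (b - a) = i + b by omega]⟩
      have hcyc : IsCycle G d (fun t => c (i + t)) := by
        refine ⟨hd, fun t ht => hc (i + t) (by omega), hi.symm, fun a ha b hb hab => ?_⟩
        rcases lt_trichotomy a b with hlt' | rfl | hlt'
        · exact (hlt a b hlt' hb hab).elim
        · rfl
        · exact (hlt b a hlt' ha hab.symm).elim
      have h₁ := h d _ hcyc
      -- The walk with the piece from `i` to `i + d` cut out; `c i = c (i + d)` glues the ends.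
      let e : ℕ → α := fun t => if t ≤ i then c t else c (t + d)
      have he₁ : ∀ t ≤ i, e t = c t := fun t ht => if_pos ht
      have he₂ : ∀ t, e (i + t) = c (i + (d + t)) := fun t => by
        rcases Nat.eq_zero_or_pos t with rfl | ht
        · rw [add_zero, add_zero, he₁ i le_rfl, hi]
        · simp only [e]
          rw [if_neg (by omega), show i + t + d = i + (d + t) by omega]
      have h₂ := ih (i + q) (by omega) e fun t ht => by
        rcases lt_or_ge t i with hti | hti
        · rw [he₁ t hti.le, he₁ (t + 1) hti]
          exact hc t (by omega)
        · obtain ⟨u, rfl⟩ := Nat.exists_eq_add_of_le hti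
          rw [add_assoc, he₂, he₂]
          exact hc (i + (d + u)) (by omega)
      rw [Finset.sum_range_add] at h₂ ⊢
      rw [Finset.sum_range_add _ d q]
      have h₃ : ∑ t ∈ Finset.range i, w (e t) (e (t + 1))
          = ∑ t ∈ Finset.range i, w (c t) (c (t + 1)) := Finset.sum_congr rfl fun t ht => by
        have := Finset.mem_range.1 ht
        rw [he₁ t this.le, he₁ (t + 1) this]
      have h₄ : ∑ t ∈ Finset.range q, w (e (i + t)) (e (i + t + 1))
          = ∑ t ∈ Finset.range q, w (c (i + (d + t))) (c (i + (d + t) + 1)) :=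
        Finset.sum_congr rfl fun t _ => by
          rw [add_assoc i t 1, he₂, he₂]
          rfl
      rw [h₃, h₄] at h₂
      simp only [← add_assoc] at h₁ h₂ ⊢
      linarith
    · push Not at hrep
      have hinj : Function.Injective fun t : Fin n => c t := by
        intro a b hab
        rcases lt_trichotomy a.1 b.1 with hlt | heq | hlt
        · refine (hrep (b - a) (by omega) a (by omega) ?_).elim
          rw [show a.1 + (b.1 - a.1) = b.1 by omega]
          exact hab
        · exact Fin.ext heq
        · refine (hrep (a - b) (by omega) b (by omega) ?_).elim
          rw [show b.1 + (a.1 - b.1) = a.1 by omega]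
          exact hab.symm
      have hcard : n ≤ Fintype.card α := by simpa using Fintype.card_le_of_injective _ hinj
      calc ∑ i ∈ Finset.range n, w (c i) (c (i + 1)) ≤ ∑ i ∈ Finset.range n, B :=
            Finset.sum_le_sum fun _ _ => hwB _ _
        _ = n * B := by simp
        _ ≤ Fintype.card α * B := by gcongr

theorem IsCycle.length_le_card [Finite α] {m : ℕ} {c : ℕ → α} (hc : IsCycle G m c) :
    m ≤ Nat.card α := by
  have := Fintype.ofFinite α
  have hinj : Function.Injective fun t : Fin m => c t :=
    fun a b hab => Fin.ext (hc.inj a a.2 b b.2 hab)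
  simpa [Nat.card_eq_fintype_card] using Fintype.card_le_of_injective _ hinj

/-- A quantity attached to cycles that depends only on the vertices of the cycle takes finitely
many values. -/
theorem finite_cycle_values [Finite α] {β : Type*} (f : ℕ → (ℕ → α) → β)
    (hf : ∀ m c c', (∀ i ≤ m, c i = c' i) → f m c = f m c') :
    {b | ∃ m c, IsCycle G m c ∧ f m c = b}.Finite := by
  let K := Nat.card α
  -- A cycle has length at most `K`, so it is coded by its length and finitely many values. The
  -- wrap-around in `Fin.ofNat` affects only indices above `K`, which `f` never sees.
  have hfin : (Set.range fun p : Fin (K + 1) × (Fin (K + 1) → α) =>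
      f p.1 fun i => p.2 (Fin.ofNat (K + 1) i)).Finite := Set.finite_range _
  refine hfin.subset ?_
  rintro b ⟨m, c, hc, rfl⟩
  have hm : m < K + 1 := Nat.lt_succ_of_le hc.length_le_card
  refine ⟨(⟨m, hm⟩, fun i => c i), hf _ _ _ fun i hi => ?_⟩
  have : i % (K + 1) = i := Nat.mod_eq_of_lt (lt_of_le_of_lt hi hm)
  simp [Fin.ofNat, this]

/-- A finite digraph with a cycle has a maximum-mean-cycle. -/
theorem exists_isMaxMeanCycle [Finite α] (hG : ∃ m c, IsCycle G m c) :
    ∃ m c, IsMaxMeanCycle G w m c := by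
  have hfin := finite_cycle_values (G := G) (fun m c => cycleMean w m c) fun m c c' h => by
    simp only [cycleMean]
    congr 1
    refine Finset.sum_congr rfl fun i hi => ?_
    have := Finset.mem_range.1 hi
    rw [h i this.le, h (i + 1) this]
  obtain ⟨m₀, c₀, h₀⟩ := hG
  obtain ⟨-, ⟨m, c, hc, rfl⟩, hmax⟩ := hfin.exists_maximal ⟨_, m₀, c₀, h₀, rfl⟩
  exact ⟨m, c, hc, fun m' c' hc' => (le_total _ _).elim id (hmax ⟨m', c', hc', rfl⟩)⟩

/-- The weight of a walk is at most its length times the maximum cycle mean, up to a constant. -/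
theorem IsMaxMeanCycle.exists_walk_weight_le [Finite α] {m : ℕ} {c : ℕ → α}
    (h : IsMaxMeanCycle G w m c) :
    ∃ K : ℝ, ∀ (n : ℕ) (p : ℕ → α), (∀ i < n, G.Adj (p i) (p (i + 1))) →
      ∑ i ∈ Finset.range n, w (p i) (p (i + 1)) ≤ n * cycleMean w m c + K := by
  -- Subtracting the maximum mean from every edge makes all cycle weights nonpositive.
  obtain ⟨K, hK⟩ := Multiflow.exists_walk_weight_le (G := G)
    (w := fun x y => w x y - cycleMean w m c) fun m' c' hc' => by
      have := h.2 m' c' hc'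
      rw [cycleMean, div_le_iff₀ (by exact_mod_cast hc'.pos)] at this
      simp only [Finset.sum_sub_distrib, Finset.sum_const, Finset.card_range, nsmul_eq_mul]
      linarith
  refine ⟨K, fun n p hp => ?_⟩
  have := hK n p hp
  simp only [Finset.sum_sub_distrib, Finset.sum_const, Finset.card_range, nsmul_eq_mul] at this
  linarith

end Walks

/-! ### Averages of periodic sequences -/

theorem sum_range_mul_eq (f : ℕ → ℝ) (K M : ℕ) :
    ∑ t ∈ Finset.range (K * M), f t
      = ∑ j ∈ Finset.range K, ∑ r ∈ Finset.range M, f (j * M + r) := by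
  induction K with
  | zero => simp
  | succ K ih => rw [Nat.succ_mul, Finset.sum_range_add, ih, Finset.sum_range_succ]

/-- Centred at the mean over one period, the partial sums are themselves periodic, hence bounded,
and vanish after division by `n`. -/
theorem tendsto_average_of_periodic {f : ℕ → ℝ} {M : ℕ} (hM : 0 < M) (hf : ∀ t, f (t + M) = f t) :
    Tendsto (fun n : ℕ => (∑ t ∈ Finset.range n, f t) / (n : ℝ)) atTop
      (𝓝 ((∑ t ∈ Finset.range M, f t) / M)) := by
  set s := (∑ t ∈ Finset.range M, f t) / M with hs
  have hM' : (M : ℝ) ≠ 0 := by exact_mod_cast hM.ne'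
  set d : ℕ → ℝ := fun n => ∑ t ∈ Finset.range n, (f t - s) with hd
  have hper : Function.Periodic d M := by
    intro n
    simp only [hd]
    induction n with
    | zero => simp [hs, mul_div_cancel₀ _ hM']
    | succ n ih => rw [Nat.add_right_comm, Finset.sum_range_succ, ih, hf, Finset.sum_range_succ]
  have hbdd : ∀ n, |d n| ≤ ∑ r ∈ Finset.range M, |d r| := fun n => by
    rw [← hper.map_mod_nat n]
    exact Finset.single_le_sum (f := fun r => |d r|) (fun _ _ => abs_nonneg _)
      (Finset.mem_range.2 (Nat.mod_lt n hM))
  have hlim : Tendsto (fun n : ℕ => d n / (n : ℝ)) atTop (𝓝 0) := by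
    refine squeeze_zero_norm (fun n => ?_)
      (tendsto_const_div_atTop_nhds_zero_nat (∑ r ∈ Finset.range M, |d r|))
    rw [Real.norm_eq_abs, abs_div, Nat.abs_cast]
    exact div_le_div_of_nonneg_right (hbdd n) (Nat.cast_nonneg n)
  have := hlim.const_add s
  rw [add_zero] at this
  refine this.congr' ?_
  filter_upwards [eventually_gt_atTop 0] with n hn
  have hn' : (n : ℝ) ≠ 0 := by exact_mod_cast hn.ne'
  simp only [hd, Finset.sum_sub_distrib, Finset.sum_const, Finset.card_range, nsmul_eq_mul]
  field_simp
  ring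

/-! ### Collision-free schedules -/

section Schedules

variable {V L : Type*} {N : Network V L} {T : ℕ}

theorem Network.CollisionFree.shift {S : Schedule L} (hS : N.CollisionFree S) (a : ℕ) :
    N.CollisionFree fun l t => S l (t + a) :=
  fun l l' t t' hl h => hS l l' (t + a) (t' + a) hl (by push_cast; linarith)

/-- The schedule that concatenates the matrices `c 0, c 1, …`. -/
def concatSchedule (hT : 0 < T) (c : ℕ → N.SchedVertex T) : Schedule L :=
  fun l t => (c (t / T)).1 l ⟨t % T, Nat.mod_lt t hT⟩

/-- Slots at distance at most `T` lie in the same block or in adjacent ones. A single edge covers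
both, and the collision-free schedule witnessing that edge excludes the collision. -/
theorem collisionFree_concatSchedule (hT : 0 < T)
    (hdelay : ∀ l, ∀ l' ∈ N.collision l, |N.delay l l'| ≤ (T : ℤ)) {c : ℕ → N.SchedVertex T}
    (hc : ∀ j, (N.schedulingGraph T).Adj (c j) (c (j + 1))) :
    N.CollisionFree (concatSchedule hT c) := by
  have key : ∀ j, ∃ S : Schedule L, N.CollisionFree S ∧ ∀ l t, t / T = j ∨ t / T = j + 1 →
      concatSchedule hT c l t = S l (t - j * T) ∧ j * T ≤ t := by
    intro j
    obtain ⟨S, hS, h₀, h₁⟩ := hc j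
    refine ⟨S, hS, fun l t ht => ?_⟩
    have hdm := Nat.div_add_mod' t T
    rcases ht with ht | ht
    · rw [ht] at hdm
      refine ⟨?_, by omega⟩
      simp only [concatSchedule]
      rw [ht, ← h₀, Schedule.block]
      dsimp only
      congr 1
      omega
    · rw [ht, Nat.succ_mul] at hdm
      refine ⟨?_, by omega⟩
      simp only [concatSchedule]
      rw [ht, ← h₁, Schedule.block]
      dsimp only
      congr 1
      omega
  rintro l l' t t' hl h ⟨h₁, h₂⟩
  have hd := abs_le.1 (hdelay l l' hl)
  have hdm := Nat.div_add_mod' t T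
  have hdm' := Nat.div_add_mod' t' T
  have hm := Nat.mod_lt t hT
  have hm' := Nat.mod_lt t' hT
  have hle : t / T ≤ t' / T + 1 := by
    rw [← Nat.add_div_right _ hT]
    exact Nat.div_le_div_right (by omega)
  have hle' : t' / T ≤ t / T + 1 := by
    rw [← Nat.add_div_right _ hT]
    exact Nat.div_le_div_right (by omega)
  obtain ⟨j, hj, hj'⟩ : ∃ j, (t / T = j ∨ t / T = j + 1) ∧ (t' / T = j ∨ t' / T = j + 1) := by
    refine ⟨min (t / T) (t' / T), ?_, ?_⟩ <;> omega
  obtain ⟨S, hS, hSeq⟩ := key j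
  obtain ⟨e, hle₁⟩ := hSeq l t hj
  obtain ⟨e', hle₂⟩ := hSeq l' t' hj'
  refine hS l l' (t - j * T) (t' - j * T) hl ?_ ⟨e ▸ h₁, e' ▸ h₂⟩
  rw [Nat.cast_sub hle₁, Nat.cast_sub hle₂]
  linarith

theorem collisionFree_periodicSchedule (hT : 0 < T)
    (hdelay : ∀ l, ∀ l' ∈ N.collision l, |N.delay l l'| ≤ (T : ℤ)) {m : ℕ}
    {c : ℕ → N.SchedVertex T} (hc : IsCycle (N.schedulingGraph T) m c) :
    N.CollisionFree (periodicSchedule hT m c) := by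
  refine collisionFree_concatSchedule (c := fun j => c (j % m)) hT hdelay fun j => ?_
  have hlt := Nat.mod_lt j hc.pos
  have hadj := hc.adj _ hlt
  by_cases hj : j % m + 1 = m
  · have : (j + 1) % m = 0 := by
      rw [← Nat.mod_add_mod, hj, Nat.mod_self]
    rw [this, ← hc.closed]
    rwa [hj] at hadj
  · have : (j + 1) % m = j % m + 1 := by
      rw [← Nat.mod_add_mod, Nat.mod_eq_of_lt (by omega)]
    rwa [this]

theorem isRateVector_of_periodic {S : Schedule L} {M : ℕ} (hM : 0 < M)
    (hS : ∀ l t, S l (t + M) = S l t) :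
    IsRateVector S fun l => (∑ t ∈ Finset.range M, ((S l t).toNat : ℝ)) / M :=
  fun l => tendsto_average_of_periodic hM fun t => by rw [hS]

/-- The rate vector of the periodic schedule given by the matrices `c 0, …, c (m - 1)`. -/
noncomputable def cycleRate (m : ℕ) (c : ℕ → N.SchedVertex T) (l : L) : ℝ :=
  (∑ j ∈ Finset.range m, ∑ t : Fin T, (((c j).1 l t).toNat : ℝ)) / (m * T)

theorem isRateVector_periodicSchedule (hT : 0 < T) {m : ℕ} (hm : 0 < m)
    (c : ℕ → N.SchedVertex T) :
    IsRateVector (periodicSchedule hT m c) (cycleRate m c) := by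
  have h := isRateVector_of_periodic (S := periodicSchedule hT m c) (M := m * T)
    (Nat.mul_pos hm hT) fun l t => by
      simp only [periodicSchedule, Nat.add_mul_mod_self_right, Nat.add_mul_div_right _ _ hT,
        Nat.add_mod_right]
  convert h using 2 with l
  rw [cycleRate, sum_range_mul_eq, Nat.cast_mul]
  congr 1
  refine Finset.sum_congr rfl fun j hj => ?_
  rw [← Fin.sum_univ_eq_sum_range (fun r => ((periodicSchedule hT m c l (j * T + r)).toNat : ℝ))]
  refine Finset.sum_congr rfl fun t _ => ?_
  have h₁ : (j * T + t) / T = j := by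
    rw [mul_comm, Nat.mul_add_div hT, Nat.div_eq_of_lt t.2, add_zero]
  have h₂ : (j * T + t) % T = t := by
    rw [mul_comm, Nat.mul_add_mod, Nat.mod_eq_of_lt t.2]
  simp only [periodicSchedule, h₁, h₂, Nat.mod_eq_of_lt (Finset.mem_range.1 hj)]

theorem IsRateVector.unique {S : Schedule L} {R Q : L → ℝ} (hR : IsRateVector S R)
    (hQ : IsRateVector S Q) : R = Q :=
  funext fun l => tendsto_nhds_unique (hR l) (hQ l)

theorem IsRateVector.nonneg {S : Schedule L} {R : L → ℝ} (hR : IsRateVector S R) (l : L) :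
    0 ≤ R l :=
  ge_of_tendsto' (hR l) fun n => by positivity

theorem IsRateVector.mem_rateRegion {S : Schedule L} {R : L → ℝ} (hR : IsRateVector S R)
    (hS : N.CollisionFree S) : R ∈ N.rateRegion :=
  ⟨hR.nonneg, fun ε hε => ⟨S, R, hS, hR, fun l => by linarith⟩⟩

theorem cycleRate_mem_rateRegion (hT : 0 < T)
    (hdelay : ∀ l, ∀ l' ∈ N.collision l, |N.delay l l'| ≤ (T : ℤ)) {m : ℕ}
    {c : ℕ → N.SchedVertex T} (hc : IsCycle (N.schedulingGraph T) m c) :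
    cycleRate m c ∈ N.rateRegion :=
  (isRateVector_periodicSchedule hT hc.pos c).mem_rateRegion
    (collisionFree_periodicSchedule hT hdelay hc)

/-! ### Convexity of the rate region -/

/-- Frames of length `M`; frame `j` carries the first `n` slots of the schedule `W j`. -/
def frameSchedule (M n : ℕ) (W : ℕ → Schedule L) : Schedule L :=
  fun l t => decide (t % M < n) && W (t / M) l (t % M)

/-- The last `T` slots of each frame are idle, so active slots in different frames are more than `T`
apart; within a frame only `W j` matters. -/
theorem collisionFree_frameSchedule
    (hdelay : ∀ l, ∀ l' ∈ N.collision l, |N.delay l l'| ≤ (T : ℤ)) {n : ℕ} {W : ℕ → Schedule L}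
    (hW : ∀ j, N.CollisionFree (W j)) : N.CollisionFree (frameSchedule (n + T) n W) := by
  rintro l l' t t' hl h ⟨h₁, h₂⟩
  simp only [frameSchedule, Bool.and_eq_true, decide_eq_true_eq] at h₁ h₂
  have hd := abs_le.1 (hdelay l l' hl)
  have hdm := Nat.div_add_mod' t (n + T)
  have hdm' := Nat.div_add_mod' t' (n + T)
  rcases lt_trichotomy (t / (n + T)) (t' / (n + T)) with hlt | heq | hlt
  · have := Nat.mul_le_mul_right (n + T) (Nat.succ_le_of_lt hlt)
    rw [Nat.succ_mul] at this
    omega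
  · refine hW _ l l' _ _ hl ?_ ⟨h₁.2, heq ▸ h₂.2⟩
    rw [heq] at hdm
    omega
  · have := Nat.mul_le_mul_right (n + T) (Nat.succ_le_of_lt hlt)
    rw [Nat.succ_mul] at this
    omega

/-- Time sharing: in every period of `K` frames, the first `p` carry `S`, the others `S'`. -/
def shareSchedule (T n K p : ℕ) (S S' : Schedule L) : Schedule L :=
  frameSchedule (n + T) n fun j => if j % K < p then S else S'

theorem isRateVector_shareSchedule (hT : 0 < T) {n K p : ℕ} (hK : 0 < K) (hp : p ≤ K)
    (S S' : Schedule L) :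
    IsRateVector (shareSchedule T n K p S S') fun l =>
      (p * ∑ t ∈ Finset.range n, ((S l t).toNat : ℝ)
        + (K - p) * ∑ t ∈ Finset.range n, ((S' l t).toNat : ℝ)) / (K * (n + T)) := by
  have hM : 0 < n + T := by omega
  have h := isRateVector_of_periodic (S := shareSchedule T n K p S S') (M := K * (n + T))
    (Nat.mul_pos hK hM) fun l t => by
      simp only [shareSchedule, frameSchedule, Nat.add_mul_mod_self_right,
        Nat.add_mul_div_right _ _ hM, Nat.add_mod_right]
  convert h using 2 with l
  rw [sum_range_mul_eq]
  push_cast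
  congr 1
  have hframe : ∀ j, ∑ r ∈ Finset.range (n + T),
      ((shareSchedule T n K p S S' l (j * (n + T) + r)).toNat : ℝ)
        = ∑ r ∈ Finset.range n, (((if j % K < p then S else S') l r).toNat : ℝ) := fun j => by
    have hval : ∀ r < n + T, shareSchedule T n K p S S' l (j * (n + T) + r)
        = (decide (r < n) && (if j % K < p then S else S') l r) := fun r hr => by
      have h₁ : (j * (n + T) + r) / (n + T) = j := by
        rw [mul_comm, Nat.mul_add_div hM, Nat.div_eq_of_lt hr, add_zero]
      have h₂ : (j * (n + T) + r) % (n + T) = r := by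
        rw [mul_comm, Nat.mul_add_mod, Nat.mod_eq_of_lt hr]
      simp only [shareSchedule, frameSchedule, h₁, h₂]
    rw [Finset.sum_range_add, add_eq_left.2]
    · refine Finset.sum_congr rfl fun r hr => ?_
      have := Finset.mem_range.1 hr
      rw [hval r (by omega), decide_eq_true this, Bool.true_and]
    · refine Finset.sum_eq_zero fun r hr => ?_
      have := Finset.mem_range.1 hr
      rw [hval (n + r) (by omega), decide_eq_false (by omega), Bool.false_and]
      simp
  simp only [hframe]
  obtain ⟨q, rfl⟩ := Nat.exists_eq_add_of_le hp
  rw [Finset.sum_range_add]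
  have h₁ : ∀ j ∈ Finset.range p,
      ∑ r ∈ Finset.range n, (((if j % (p + q) < p then S else S') l r).toNat : ℝ)
        = ∑ r ∈ Finset.range n, ((S l r).toNat : ℝ) := fun j hj => by
    have := Finset.mem_range.1 hj
    rw [Nat.mod_eq_of_lt (by omega), if_pos this]
  have h₂ : ∀ j ∈ Finset.range q,
      ∑ r ∈ Finset.range n, (((if (p + j) % (p + q) < p then S else S') l r).toNat : ℝ)
        = ∑ r ∈ Finset.range n, ((S' l r).toNat : ℝ) := fun j hj => by
    have := Finset.mem_range.1 hj
    rw [Nat.mod_eq_of_lt (by omega), if_neg (by omega)]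
  rw [Finset.sum_congr rfl h₁, Finset.sum_congr rfl h₂]
  simp

/-- The rate region is convex: time sharing with guard intervals. -/
theorem convex_rateRegion [Finite L] (hT : 0 < T)
    (hdelay : ∀ l, ∀ l' ∈ N.collision l, |N.delay l l'| ≤ (T : ℤ)) : Convex ℝ N.rateRegion := by
  rintro R hR R' hR' a b ha hb hab
  refine ⟨fun l => ?_, fun ε hε => ?_⟩
  · exact add_nonneg (mul_nonneg ha (hR.1 l)) (mul_nonneg hb (hR'.1 l))
  obtain ⟨S, Q, hS, hQ, hRQ⟩ := hR.2 ε hε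
  obtain ⟨S', Q', hS', hQ', hRQ'⟩ := hR'.2 ε hε
  -- `n` frames per period, with `⌊a * n⌋₊` of them given to `S`: as `n` grows this share tends to
  -- `a` and the guard factor `n / (n + T)` to `1`.
  let X : ℕ → L → ℝ := fun n l =>
    (⌊a * n⌋₊ * ∑ t ∈ Finset.range n, ((S l t).toNat : ℝ)
      + (n - ⌊a * n⌋₊) * ∑ t ∈ Finset.range n, ((S' l t).toNat : ℝ)) / (n * (n + T))
  have hlim : ∀ l, Tendsto (fun n => X n l) atTop (𝓝 (a * Q l + b * Q' l)) := fun l => by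
    have hfl : Tendsto (fun n : ℕ => (⌊a * n⌋₊ : ℝ) / n) atTop (𝓝 a) :=
      (tendsto_nat_floor_mul_div_atTop ha).comp tendsto_natCast_atTop_atTop
    have hT' : Tendsto (fun n : ℕ => (n : ℝ) / (n + T)) atTop (𝓝 1) :=
      tendsto_natCast_div_add_atTop (T : ℝ)
    have := ((hfl.mul (hQ l)).add ((hfl.const_sub 1).mul (hQ' l))).mul hT'
    rw [mul_one, ← eq_sub_iff_add_eq'.2 hab] at this
    refine this.congr' ?_
    filter_upwards [eventually_gt_atTop 0] with n hn
    have hn' : (n : ℝ) ≠ 0 := by exact_mod_cast hn.ne'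
    have hnT : (n : ℝ) + T ≠ 0 := by positivity
    simp only [X]
    field_simp
  have hev : ∀ᶠ n in atTop, ∀ l, (a • R + b • R') l - ε < X n l := by
    refine eventually_all.2 fun l => (hlim l).eventually_const_lt ?_
    simp only [Pi.add_apply, Pi.smul_apply, smul_eq_mul]
    have h₁ := hRQ l
    have h₂ := hRQ' l
    -- Strictness is drawn from `S` when `a > 0`, and from `S'` when `a = 0` and `b = 1`.
    rcases ha.eq_or_lt with rfl | ha
    · rw [zero_add] at hab
      subst hab
      linarith
    · nlinarith [mul_lt_mul_of_pos_left h₁ ha, mul_le_mul_of_nonneg_left h₂.le hb,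
        congrArg (· * ε) hab]
  obtain ⟨n, hn, hn0⟩ := (hev.and (eventually_gt_atTop 0)).exists
  have hp : ⌊a * n⌋₊ ≤ n := by
    refine Nat.floor_le_of_le ?_
    have : a ≤ 1 := by linarith
    nlinarith [(Nat.cast_nonneg n : (0 : ℝ) ≤ n)]
  refine ⟨shareSchedule T n n ⌊a * n⌋₊ S S', X n, ?_,
    isRateVector_shareSchedule hT hn0 hp S S', hn⟩
  refine collisionFree_frameSchedule hdelay fun j => ?_
  split_ifs
  exacts [hS, hS']

/-! ### The scheduling graph -/

instance [Finite L] : Finite (N.SchedVertex T) :=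
  inferInstanceAs (Finite {A : L → Fin T → Bool // ∃ S : Schedule L, N.CollisionFree S ∧
    S.block T 0 = A})

/-- The idle schedule gives a loop at the zero matrix, so the search for a maximum-mean-cycle is
never over an empty set. -/
theorem exists_isCycle_schedulingGraph (N : Network V L) (T : ℕ) :
    ∃ m c, IsCycle (N.schedulingGraph T) m c := by
  have hS : N.CollisionFree fun _ _ => false := fun _ _ _ _ _ _ h => by simp at h
  let A : N.SchedVertex T := ⟨fun _ _ => false, fun _ _ => false, hS, rfl⟩
  refine ⟨1, fun _ => A, one_pos, fun _ _ => ⟨fun _ _ => false, hS, rfl, rfl⟩, rfl,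
    fun i hi j hj _ => by omega⟩

/-- The finitely many rate vectors that the algorithm can meet. -/
theorem finite_cycleRates [Finite L] (N : Network V L) (T : ℕ) :
    {R | ∃ m c, IsCycle (N.schedulingGraph T) m c ∧ cycleRate m c = R}.Finite :=
  finite_cycle_values (fun m c => cycleRate m c) fun m c c' h => by
    funext l
    simp only [cycleRate]
    congr 1
    refine Finset.sum_congr rfl fun j hj => ?_
    rw [h j (Finset.mem_range.1 hj).le]

variable [Fintype L]

/-- An edge is charged for its head only, and the heads along a cycle are its vertices shifted by
one. The factor `T` converts weight per block into rate per slot. -/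
theorem IsCycle.cycleMean_eq (hT : 0 < T) (a : L → ℝ) {m : ℕ} {c : ℕ → N.SchedVertex T}
    (hc : IsCycle (N.schedulingGraph T) m c) :
    cycleMean (N.weight T a) m c = T * ∑ l, a l * cycleRate m c l := by
  have hm : (m : ℝ) ≠ 0 := by exact_mod_cast hc.pos.ne'
  have hT' : (T : ℝ) ≠ 0 := by exact_mod_cast hT.ne'
  have hshift : ∑ j ∈ Finset.range m, N.weight T a (c j) (c (j + 1))
      = ∑ j ∈ Finset.range m, N.weight T a (c 0) (c j) := by
    have := (Finset.sum_range_succ' (fun j => N.weight T a (c 0) (c j)) m).symm.trans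
      (Finset.sum_range_succ _ m)
    rw [hc.closed] at this
    exact add_right_cancel this
  rw [cycleMean, hshift]
  simp only [Network.weight, cycleRate]
  rw [Finset.sum_comm, Finset.mul_sum, Finset.sum_div]
  refine Finset.sum_congr rfl fun l _ => ?_
  rw [← Finset.mul_sum]
  field_simp

/-- The rate vector of a maximum-mean-cycle maximises the weight over the rate region. -/
theorem IsMaxMeanCycle.sum_mul_le (hT : 0 < T) {μ : L → ℝ} (hμ : ∀ l, 0 ≤ μ l) {m : ℕ}
    {c : ℕ → N.SchedVertex T} (hc : IsMaxMeanCycle (N.schedulingGraph T) (N.weight T μ) m c)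
    {R : L → ℝ} (hR : R ∈ N.rateRegion) :
    ∑ l, μ l * R l ≤ ∑ l, μ l * cycleRate m c l := by
  have hT' : (0 : ℝ) < T := by exact_mod_cast hT
  obtain ⟨K, hK⟩ := hc.exists_walk_weight_le
  rw [hc.1.cycleMean_eq hT] at hK
  set z := ∑ l, μ l * cycleRate m c l with hz
  have key : ∀ (S : Schedule L) (Q : L → ℝ), N.CollisionFree S → IsRateVector S Q →
      ∑ l, μ l * Q l ≤ z := by
    intro S Q hS hQ
    -- The blocks of `S` form a walk because time shifts preserve collision freeness.
    let p : ℕ → N.SchedVertex T := fun j => ⟨S.block T j, _, hS.shift (j * T), by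
      funext l t
      simp [Schedule.block, add_comm]⟩
    have hp : ∀ j, (N.schedulingGraph T).Adj (p j) (p (j + 1)) := fun j =>
      ⟨_, hS.shift (j * T), by
        funext l t
        simp [Schedule.block, p, add_comm], by
        funext l t
        simp only [Schedule.block, p]
        congr 1
        ring⟩
    -- The first block is the head of no edge of the walk, so its weight enters separately; `- T *
    -- z` turns `n` blocks into `n + 1`.
    let K' := K - T * z + ∑ l, μ l * ∑ t ∈ Finset.range T, ((S l t).toNat : ℝ)
    have hlim : Tendsto (fun n : ℕ => ∑ l, μ l *
        ((∑ t ∈ Finset.range ((n + 1) * T), ((S l t).toNat : ℝ)) / ((n + 1) * T : ℕ))) atTop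
        (𝓝 (∑ l, μ l * Q l)) := by
      refine tendsto_finsetSum _ fun l _ => Tendsto.const_mul _ ?_
      refine (hQ l).comp ?_
      exact (tendsto_add_atTop_nat 1).atTop_mul_const' hT
    have hlim' : Tendsto (fun n : ℕ => z + K' / T * (1 / ((n : ℝ) + 1))) atTop (𝓝 z) := by
      simpa using (tendsto_one_div_add_atTop_nhds_zero_nat (𝕜 := ℝ)).const_mul (K' / T)
        |>.const_add z
    refine le_of_tendsto_of_tendsto' hlim hlim' fun n => ?_
    have hn := hK n p fun i _ => hp i
    have hw : ∑ i ∈ Finset.range n, N.weight T μ (p i) (p (i + 1))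
        + ∑ l, μ l * ∑ t ∈ Finset.range T, ((S l t).toNat : ℝ)
        = ∑ l, μ l * ∑ t ∈ Finset.range ((n + 1) * T), ((S l t).toNat : ℝ) := by
      simp only [Network.weight, p, Schedule.block]
      rw [Finset.sum_comm, ← Finset.sum_add_distrib]
      refine Finset.sum_congr rfl fun l _ => ?_
      rw [sum_range_mul_eq, Finset.sum_range_succ', ← Finset.mul_sum, ← mul_add]
      simp only [zero_mul, zero_add]
      congr 2
      refine Finset.sum_congr rfl fun i _ => ?_
      exact Fin.sum_univ_eq_sum_range (fun t => ((S l ((i + 1) * T + t)).toNat : ℝ)) T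
    have hn0 : (0 : ℝ) < n + 1 := by positivity
    have hle : ∑ l, μ l * ∑ t ∈ Finset.range ((n + 1) * T), ((S l t).toNat : ℝ)
        ≤ (n + 1) * T * z + K' := by
      rw [← hw]
      simp only [K']
      linarith
    simp only [← mul_div_assoc]
    rw [← Finset.sum_div, div_le_iff₀ (by positivity)]
    refine hle.trans (le_of_eq ?_)
    push_cast
    field_simp
  -- Achievable rates come within `ε` of `R` from below only; nonnegativity of `μ` makes this
  -- enough.
  have hε : ∀ ε : ℝ, 0 < ε → ∑ l, μ l * R l ≤ z + ε * ∑ l, μ l := fun ε hε => by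
    obtain ⟨S, Q, hS, hQ, hRQ⟩ := hR.2 ε hε
    have := key S Q hS hQ
    refine le_trans ?_ (add_le_add_left this _)
    rw [Finset.mul_sum, ← Finset.sum_add_distrib]
    refine Finset.sum_le_sum fun l _ => ?_
    nlinarith [mul_le_mul_of_nonneg_left (hRQ l).le (hμ l)]
  have hlim : Tendsto (fun ε : ℝ => z + ε * ∑ l, μ l) (𝓝[>] 0) (𝓝 z) := by
    have : Tendsto (fun ε : ℝ => z + ε * ∑ l, μ l) (𝓝 0) (𝓝 (z + 0 * ∑ l, μ l)) :=
      Continuous.tendsto (by fun_prop) 0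
    rw [zero_mul, add_zero] at this
    exact this.mono_left nhdsWithin_le_nhds
  exact ge_of_tendsto hlim (eventually_mem_nhdsWithin.mono fun ε h => hε ε h)

end Schedules

/-! ### The linear programs -/

section LinearPrograms

variable {V L : Type*} [Fintype L] {k : ℕ} {N : Network V L} {C : Sessions V k}
  {obj : Objective k}

theorem Network.inFlow_add (N : Network V L) (F F' : L → ℝ) (u : V) :
    N.inFlow (F + F') u = N.inFlow F u + N.inFlow F' u := Finset.sum_add_distrib

theorem Network.outFlow_add (N : Network V L) (F F' : L → ℝ) (u : V) :
    N.outFlow (F + F') u = N.outFlow F u + N.outFlow F' u := Finset.sum_add_distrib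

theorem Network.inFlow_smul (N : Network V L) (r : ℝ) (F : L → ℝ) (u : V) :
    N.inFlow (r • F) u = r * N.inFlow F u := (Finset.mul_sum _ _ _).symm

theorem Network.outFlow_smul (N : Network V L) (r : ℝ) (F : L → ℝ) (u : V) :
    N.outFlow (r • F) u = r * N.outFlow F u := (Finset.mul_sum _ _ _).symm

theorem Network.inFlow_zero (N : Network V L) (u : V) : N.inFlow 0 u = 0 :=
  Finset.sum_const_zero

theorem Network.outFlow_zero (N : Network V L) (u : V) : N.outFlow 0 u = 0 :=
  Finset.sum_const_zero

theorem Objective.HasValue.add {v v' : Fin k → ℝ} {z z' : ℝ} (h : obj.HasValue v z)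
    (h' : obj.HasValue v' z') : obj.HasValue (v + v') (z + z') := by
  cases obj with
  | total =>
    simp only [HasValue] at h h' ⊢
    simp [h, h', Finset.sum_add_distrib]
  | concurrent γ =>
    intro i
    rw [Pi.add_apply, h i, h' i, add_mul]

theorem Objective.HasValue.smul {v : Fin k → ℝ} {z : ℝ} (h : obj.HasValue v z) (r : ℝ) :
    obj.HasValue (r • v) (r * z) := by
  cases obj with
  | total =>
    simp only [HasValue] at h ⊢
    simp [h, Finset.mul_sum]
  | concurrent γ =>
    intro i
    rw [Pi.smul_apply, h i, smul_eq_mul, mul_assoc]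

theorem Objective.hasValue_zero (obj : Objective k) : obj.HasValue 0 0 := by
  cases obj with
  | total => simp [HasValue]
  | concurrent γ => simp [HasValue]

/-- Well-posedness enters here: some `γ i > 0` recovers `z` from `v i`. The bound gives compactness,
and in the duality proof it forces `z ≤ 0` when all rates vanish. -/
theorem Objective.WellPosed.exists_bound (h : obj.WellPosed) :
    ∃ M : ℝ, ∀ (v : Fin k → ℝ) (z B : ℝ), obj.HasValue v z → (∀ i, 0 ≤ v i ∧ v i ≤ B) →
      0 ≤ z ∧ z ≤ M * B := by
  cases obj with
  | total =>
    refine ⟨k, fun v z B hz hv => ?_⟩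
    obtain rfl : z = ∑ i, v i := hz
    refine ⟨Finset.sum_nonneg fun i _ => (hv i).1, ?_⟩
    calc ∑ i, v i ≤ ∑ _i : Fin k, B := Finset.sum_le_sum fun i _ => (hv i).2
      _ = k * B := by simp
  | concurrent γ =>
    obtain ⟨-, i, hi⟩ := h
    refine ⟨(γ i)⁻¹, fun v z B hz hv => ?_⟩
    have hzi : z = (γ i)⁻¹ * v i := by
      rw [hz i]
      field_simp
    rw [hzi]
    exact ⟨mul_nonneg (inv_nonneg.2 hi.le) (hv i).1,
      mul_le_mul_of_nonneg_left (hv i).2 (inv_nonneg.2 hi.le)⟩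

theorem Network.outFlow_nonneg (N : Network V L) {F : L → ℝ} (hF : ∀ l, 0 ≤ F l) (u : V) :
    0 ≤ N.outFlow F u := Finset.sum_nonneg fun l _ => hF l

theorem Network.outFlow_le_sum (N : Network V L) {F R : L → ℝ} (hF : ∀ l, 0 ≤ F l)
    (hR : ∀ l, F l ≤ R l) (u : V) : N.outFlow F u ≤ ∑ l, R l :=
  (Finset.sum_le_sum_of_subset_of_nonneg (Finset.subset_univ _) fun l _ _ => hF l).trans
    (Finset.sum_le_sum fun l _ => hR l)

/-- Bounds for the variables of the linear programs in terms of the rate vector. -/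
theorem FlowVars.Routes.bounds {x : FlowVars L C} (hx : x.Routes N) {R : L → ℝ}
    (hR : ∀ l, x.load l ≤ R l) :
    (∀ l, 0 ≤ R l) ∧ (∀ i t l, 0 ≤ x.F i t l ∧ x.F i t l ≤ R l) ∧
      (∀ i, 0 ≤ x.v i ∧ x.v i ≤ ∑ l, R l) ∧ ∀ i l, 0 ≤ x.G i l ∧ x.G i l ≤ R l := by
  have hF : ∀ i t l, 0 ≤ x.F i t l ∧ x.F i t l ≤ R l := fun i t l =>
    ⟨(hx.isFlow i t).nonneg l, (hx.isValidFlow hR i t).le_rate l⟩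
  have hG : ∀ i l, 0 ≤ x.G i l := fun i l => by
    obtain ⟨t, ht⟩ := C.sinks_nonempty i
    exact (hF i ⟨t, ht⟩ l).1.trans (hx.le_usage i ⟨t, ht⟩ l)
  refine ⟨fun l => (Finset.sum_nonneg fun i _ => hG i l).trans (hR l), hF, fun i => ?_,
    fun i l => ⟨hG i l, (Finset.single_le_sum (f := fun j => x.G j l)
      (fun j _ => hG j l) (Finset.mem_univ i)).trans (hR l)⟩⟩
  obtain ⟨t, ht⟩ := C.sinks_nonempty i
  rw [← hx.out_source i ⟨t, ht⟩]
  exact ⟨N.outFlow_nonneg (fun l => (hF i ⟨t, ht⟩ l).1) _,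
    N.outFlow_le_sum (fun l => (hF i ⟨t, ht⟩ l).1) (fun l => (hF i ⟨t, ht⟩ l).2) _⟩

/-- The ambient vector space of the variables `F`, `v`, `G` and the objective value `z`. -/
abbrev LPSpace (L : Type*) (C : Sessions V k) : Type _ :=
  ((i : Fin k) → {t // t ∈ C.sinks i} → L → ℝ) × (Fin k → ℝ) × (Fin k → L → ℝ) × ℝ

/-- The flow variables stored in a point of the ambient space. -/
def LPSpace.vars (p : LPSpace L C) : FlowVars L C := ⟨p.1, p.2.1, p.2.2.1⟩

/-- The subspace cut out by the linear equations of the programs. -/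
def lpSubspace (N : Network V L) (C : Sessions V k) (obj : Objective k) :
    Submodule ℝ (LPSpace L C) where
  carrier := {p | (∀ i (t : {t // t ∈ C.sinks i}) u, u ≠ C.source i → u ≠ t →
      N.inFlow (p.1 i t) u = N.outFlow (p.1 i t) u) ∧
    (∀ i t, N.outFlow (p.1 i t) (C.source i) = p.2.1 i) ∧
    (∀ i t, N.inFlow (p.1 i t) (t : V) = p.2.1 i) ∧ obj.HasValue p.2.1 p.2.2.2}
  zero_mem' := ⟨fun i t u _ _ => (N.inFlow_zero u).trans (N.outFlow_zero u).symm,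
    fun i t => N.outFlow_zero _, fun i t => N.inFlow_zero _, obj.hasValue_zero⟩
  add_mem' := by
    rintro p q ⟨h₁, h₂, h₃, h₄⟩ ⟨h₁', h₂', h₃', h₄'⟩
    refine ⟨fun i t u hs ht => ?_, fun i t => ?_, fun i t => ?_, h₄.add h₄'⟩
    · simp only [Prod.fst_add, Pi.add_apply, Network.inFlow_add, Network.outFlow_add,
        h₁ i t u hs ht, h₁' i t u hs ht]
    · simp only [Prod.fst_add, Prod.snd_add, Pi.add_apply, Network.outFlow_add, h₂, h₂']
    · simp only [Prod.fst_add, Prod.snd_add, Pi.add_apply, Network.inFlow_add, h₃, h₃']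
  smul_mem' := by
    rintro r p ⟨h₁, h₂, h₃, h₄⟩
    refine ⟨fun i t u hs ht => ?_, fun i t => ?_, fun i t => ?_, h₄.smul r⟩
    · simp only [Prod.smul_fst, Pi.smul_apply, Network.inFlow_smul, Network.outFlow_smul,
        h₁ i t u hs ht]
    · simp only [Prod.smul_fst, Prod.smul_snd, Pi.smul_apply, Network.outFlow_smul, h₂,
        smul_eq_mul]
    · simp only [Prod.smul_fst, Prod.smul_snd, Pi.smul_apply, Network.inFlow_smul, h₃,
        smul_eq_mul]

/-- Separates the homogeneous equations, absorbed into a subspace, from the inequalities left for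
closedness and Farkas' lemma. -/
theorem routes_and_hasValue_iff {p : LPSpace L C} :
    p.vars.Routes N ∧ obj.HasValue p.vars.v p.2.2.2 ↔
      p ∈ lpSubspace N C obj ∧ (∀ i t l, 0 ≤ p.1 i t l) ∧ ∀ i t l, p.1 i t l ≤ p.2.2.1 i l :=
  ⟨fun ⟨h, hz⟩ => ⟨⟨fun i t => (h.isFlow i t).conservation, h.out_source, h.in_sink, hz⟩,
      fun i t => (h.isFlow i t).nonneg, h.le_usage⟩,
    fun ⟨⟨h₁, h₂, h₃, h₄⟩, h₅, h₆⟩ => ⟨⟨fun i t => ⟨h₅ i t, h₁ i t⟩, h₂, h₃, h₆⟩, h₄⟩⟩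

theorem mem_lpValues_iff {P : Set (L → ℝ)} {z : ℝ} :
    z ∈ lpValues N C obj P ↔ ∃ (x : FlowVars L C) (R : L → ℝ), R ∈ P ∧ x.Routes N ∧
      obj.HasValue x.v z ∧ ∀ l, x.load l ≤ R l :=
  ⟨fun ⟨x, R, hR, hx, hz, _, hl⟩ => ⟨x, R, hR, hx, hz, hl⟩,
    fun ⟨x, R, hR, hx, hz, hl⟩ => ⟨x, R, hR, hx, hz, hx.isValidFlow hl, hl⟩⟩

theorem lpValues_mono {P P' : Set (L → ℝ)} (h : P ⊆ P') :
    lpValues N C obj P ⊆ lpValues N C obj P' :=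
  fun _ ⟨x, R, hR, hx⟩ => ⟨x, R, h hR, hx⟩

/-- The linear program over a nonempty compact set of nonnegative rate vectors has an optimal
value. -/
theorem exists_isGreatest_lpValues (hobj : obj.WellPosed) {P : Set (L → ℝ)} (hP : IsCompact P)
    (hne : P.Nonempty) (hpos : ∀ R ∈ P, ∀ l, 0 ≤ R l) :
    ∃ v, IsGreatest (lpValues N C obj P) v := by
  obtain ⟨M, hM⟩ := hobj.exists_bound
  obtain ⟨B, hB⟩ := (hP.image (f := fun R : L → ℝ => ∑ l, R l) (by fun_prop)).bddAbove
  replace hB : ∀ R ∈ P, ∑ l, R l ≤ B := fun R hR => hB ⟨R, hR, rfl⟩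
  have hBl : ∀ R ∈ P, ∀ l, R l ≤ B := fun R hR l =>
    (Finset.single_le_sum (fun j _ => hpos R hR j) (Finset.mem_univ l)).trans (hB R hR)
  obtain ⟨R₀, hR₀⟩ := hne
  have hB0 : 0 ≤ B := (Finset.sum_nonneg fun l _ => hpos R₀ hR₀ l).trans (hB R₀ hR₀)
  -- A box containing every feasible point; `max 0` keeps the zero point inside whatever the sign of
  -- `M`.
  let b : LPSpace L C := (fun _ _ _ => B, fun _ => B, fun _ _ => B, max 0 (M * B))
  let Y : Set (LPSpace L C × (L → ℝ)) := {q | q.1 ∈ lpSubspace N C obj ∧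
    (∀ i t l, 0 ≤ q.1.1 i t l) ∧ (∀ i t l, q.1.1 i t l ≤ q.1.2.2.1 i l) ∧
    ∀ l, ∑ i, q.1.2.2.1 i l ≤ q.2 l}
  have hY : IsClosed Y := by
    simp only [Y, Set.ofPred_and, Set.ofPred_forall]
    refine ((lpSubspace N C obj).closed_of_finiteDimensional.preimage continuous_fst).inter
      (IsClosed.inter ?_ (IsClosed.inter ?_ ?_))
    · exact isClosed_iInter fun i => isClosed_iInter fun t => isClosed_iInter fun l =>
        isClosed_le (by fun_prop) (by fun_prop)
    · exact isClosed_iInter fun i => isClosed_iInter fun t => isClosed_iInter fun l =>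
        isClosed_le (by fun_prop) (by fun_prop)
    · exact isClosed_iInter fun l => isClosed_le (by fun_prop) (by fun_prop)
  have hcomp : IsCompact ((Set.Icc (0 : LPSpace L C) b ×ˢ P) ∩ Y) :=
    (isCompact_Icc.prod hP).inter_right hY
  have himage : lpValues N C obj P
      = (fun q : LPSpace L C × (L → ℝ) => q.1.2.2.2) '' ((Set.Icc (0 : LPSpace L C) b ×ˢ P) ∩ Y) := by
    ext z
    rw [mem_lpValues_iff]
    constructor
    · rintro ⟨x, R, hR, hx, hz, hl⟩
      obtain ⟨hW, hF, hG⟩ := (routes_and_hasValue_iff (p := (x.F, x.v, x.G, z))).1 ⟨hx, hz⟩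
      obtain ⟨-, hFb, hvb, hGb⟩ := hx.bounds hl
      have hzb := hM x.v z B hz fun i => ⟨(hvb i).1, (hvb i).2.trans (hB R hR)⟩
      refine ⟨((x.F, x.v, x.G, z), R), ⟨⟨⟨?_, ?_⟩, hR⟩, hW, hF, hG, hl⟩, rfl⟩
      · exact ⟨fun i t l => (hFb i t l).1, fun i => (hvb i).1, fun i l => (hGb i l).1, hzb.1⟩
      · exact ⟨fun i t l => (hFb i t l).2.trans (hBl R hR l), fun i => (hvb i).2.trans (hB R hR),
          fun i l => (hGb i l).2.trans (hBl R hR l), hzb.2.trans (le_max_right _ _)⟩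
    · rintro ⟨⟨p, R⟩, ⟨⟨-, hR⟩, hW, hF, hG, hl⟩, rfl⟩
      obtain ⟨hx, hz⟩ := routes_and_hasValue_iff.2 ⟨hW, hF, hG⟩
      exact ⟨p.vars, R, hR, hx, hz, hl⟩
  rw [himage]
  refine (hcomp.image (by fun_prop)).exists_isGreatest ?_
  refine ⟨_, (0, R₀), ⟨⟨⟨le_rfl, ?_⟩, hR₀⟩, zero_mem _, fun _ _ _ => le_rfl, fun _ _ _ => le_rfl,
    fun l => ?_⟩, rfl⟩
  · exact ⟨fun _ _ _ => hB0, fun _ => hB0, fun _ _ => hB0, le_max_left _ _⟩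
  · simpa using hpos R₀ hR₀ l

/-- Strong duality for the capacity constraint of the linear program over a polytope. -/
theorem exists_isDualVector (hobj : obj.WellPosed) (s : Finset (L → ℝ)) {v : ℝ}
    (hv : IsGreatest (lpValues N C obj (convexHull ℝ (s : Set (L → ℝ)))) v) :
    ∃ μ, IsDualVector N C obj (convexHull ℝ (s : Set (L → ℝ))) v μ := by
  obtain ⟨M, hM⟩ := hobj.exists_bound
  let W := lpSubspace N C obj
  -- Homogenisation: the second component holds coefficients of the points of `s`, of which only the
  -- values on `s` matter. Their sum need not be `1`, and optimality of `v` becomes `c ≤ 0` on a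
  -- cone.
  let Q := W × ((L → ℝ) → ℝ)
  let f (i : Fin k) (t : {t // t ∈ C.sinks i}) (l : L) : Q →ₗ[ℝ] ℝ :=
    { toFun := fun q => q.1.1.1 i t l, map_add' := fun _ _ => rfl, map_smul' := fun _ _ => rfl }
  let u (i : Fin k) (l : L) : Q →ₗ[ℝ] ℝ :=
    { toFun := fun q => q.1.1.2.2.1 i l, map_add' := fun _ _ => rfl, map_smul' := fun _ _ => rfl }
  let e (y : L → ℝ) : Q →ₗ[ℝ] ℝ :=
    { toFun := fun q => q.2 y, map_add' := fun _ _ => rfl, map_smul' := fun _ _ => rfl }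
  let ζ : Q →ₗ[ℝ] ℝ :=
    { toFun := fun q => q.1.1.2.2.2, map_add' := fun _ _ => rfl, map_smul' := fun _ _ => rfl }
  let a : ((i : Fin k) × {t // t ∈ C.sinks i} × L) ⊕ ((i : Fin k) × {t // t ∈ C.sinks i} × L) ⊕ s →
      Q →ₗ[ℝ] ℝ := Sum.elim (fun j => -f j.1 j.2.1 j.2.2)
    (Sum.elim (fun j => f j.1 j.2.1 j.2.2 - u j.1 j.2.2) fun y => -e y)
  let g : L → Q →ₗ[ℝ] ℝ := fun l => ∑ i, u i l - ∑ y ∈ s, y l • e y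
  let c : Q →ₗ[ℝ] ℝ := ζ - v • ∑ y ∈ s, e y
  have hg : ∀ l q, g l q = ∑ i, q.1.1.2.2.1 i l - ∑ y ∈ s, q.2 y * y l := fun l q => by
    simp [g, u, e, LinearMap.sum_apply, mul_comm]
  have hc : ∀ q, c q = q.1.1.2.2.2 - v * ∑ y ∈ s, q.2 y := fun q => by
    simp [c, ζ, e, LinearMap.sum_apply]
  have ha : ∀ q : Q, (∀ j, a j q ≤ 0) ↔ (∀ i t l, 0 ≤ q.1.1.1 i t l) ∧
      (∀ i t l, q.1.1.1 i t l ≤ q.1.1.2.2.1 i l) ∧ ∀ y ∈ s, 0 ≤ q.2 y := fun q => by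
    simp [a, f, u, e, Sum.forall, Sigma.forall]
  obtain ⟨μ, hμ, hμb⟩ := exists_lagrange_multiplier a g c fun q hq hgq => by
    obtain ⟨hF, hG, hθ⟩ := (ha q).1 hq
    have hload : ∀ l, ∑ i, q.1.1.2.2.1 i l ≤ ∑ y ∈ s, q.2 y * y l := fun l =>
      sub_nonpos.1 ((hg l q).symm.trans_le (hgq l))
    rw [hc]
    refine sub_nonpos.2 ?_
    -- If the coefficients sum to zero, no capacity is left and `z ≤ 0`; otherwise dividing by the
    -- sum gives a feasible point of the original program.
    rcases (Finset.sum_nonneg hθ).eq_or_lt with hτ | hτ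
    · have hθ0 := (Finset.sum_eq_zero_iff_of_nonneg hθ).1 hτ.symm
      obtain ⟨hx, hz⟩ := routes_and_hasValue_iff.2 ⟨q.1.2, hF, hG⟩
      obtain ⟨-, -, hvb, -⟩ := hx.bounds (R := 0) fun l => (hload l).trans
        (Finset.sum_eq_zero fun y hy => by rw [hθ0 y hy, zero_mul]).le
      have := (hM _ _ _ hz hvb).2
      rw [← hτ]
      simpa using this
    · set τ := ∑ y ∈ s, q.2 y with hτdef
      have hτi := inv_nonneg.2 hτ.le
      obtain ⟨hx, hz⟩ := routes_and_hasValue_iff.2 ⟨W.smul_mem τ⁻¹ q.1.2,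
        fun i t l => mul_nonneg hτi (hF i t l),
        fun i t l => mul_le_mul_of_nonneg_left (hG i t l) hτi⟩
      have hle := hv.2 (mem_lpValues_iff.2 ⟨_, ∑ y ∈ s, (τ⁻¹ * q.2 y) • y, ?_, hx, hz, fun l => ?_⟩)
      · have hle' : τ⁻¹ * q.1.1.2.2.2 ≤ v := hle
        rwa [inv_mul_le_iff₀ hτ, mul_comm] at hle'
      · refine Finset.mem_convexHull'.2 ⟨fun y => τ⁻¹ * q.2 y,
          fun y hy => mul_nonneg hτi (hθ y hy), ?_, rfl⟩
        rw [← Finset.mul_sum, inv_mul_cancel₀ hτ.ne']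
      · have := mul_le_mul_of_nonneg_left (hload l) hτi
        rw [Finset.mul_sum, Finset.mul_sum] at this
        simpa [FlowVars.load, LPSpace.vars, Finset.sum_apply, mul_assoc] using this
  refine ⟨μ, hμ, fun x R z hR hx hz => ?_⟩
  obtain ⟨θ, hθ, hsum, rfl⟩ := Finset.mem_convexHull'.1 hR
  obtain ⟨hW, hF, hG⟩ := (routes_and_hasValue_iff (p := (x.F, x.v, x.G, z))).1 ⟨hx, hz⟩
  have h := hμb (⟨_, hW⟩, θ) ((ha _).2 ⟨hF, hG, hθ⟩)
  have hl : ∀ l, ∑ i, x.G i l - ∑ y ∈ s, θ y * y l = x.load l - (∑ y ∈ s, θ y • y) l := fun l => by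
    simp [FlowVars.load, Finset.sum_apply]
  simp only [hc, hg, hsum, hl, mul_one] at h
  have hneg : ∑ l, μ l * ((∑ y ∈ s, θ y • y) l - x.load l)
      = -∑ l, μ l * (x.load l - (∑ y ∈ s, θ y • y) l) := by
    rw [← Finset.sum_neg_distrib]
    exact Finset.sum_congr rfl fun l _ => by ring
  rw [hneg]
  linarith

/-- If the rates over a set are priced by a dual vector of the program over a subset no higher
than on that subset, then the two programs have the same value. -/
theorem IsDualVector.isGreatest {P P' : Set (L → ℝ)} {v : ℝ} {μ R₀ : L → ℝ}
    (h : IsDualVector N C obj P v μ) (hv : IsGreatest (lpValues N C obj P) v) (hPP' : P ⊆ P')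
    (hR₀ : R₀ ∈ P) (hmax : ∀ R ∈ P', ∑ l, μ l * R l ≤ ∑ l, μ l * R₀ l) :
    IsGreatest (lpValues N C obj P') v := by
  refine ⟨lpValues_mono hPP' hv.1, fun z hz => ?_⟩
  obtain ⟨x, R, hR, hx, hz, hl⟩ := mem_lpValues_iff.1 hz
  -- The flows are feasible for `R`, but the bound is evaluated at `R₀ ∈ P`: the relaxed program
  -- does not require `x` to fit under `R₀`.
  have h₁ := h.bound x R₀ z hR₀ hx hz
  have h₂ := hmax R hR
  have h₃ : ∑ l, μ l * x.load l ≤ ∑ l, μ l * R l :=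
    Finset.sum_le_sum fun l _ => mul_le_mul_of_nonneg_left (hl l) (h.nonneg l)
  simp only [mul_sub, Finset.sum_sub_distrib] at h₁
  linarith

end LinearPrograms

/-! ### The algorithm -/

section Optimality

variable {V L : Type*} {N : Network V L}

/-- The sets of rate vectors held by the algorithm: polytopes inside the rate region. -/
def IsRatePolytope (N : Network V L) (P : Set (L → ℝ)) : Prop :=
  (∃ s : Finset (L → ℝ), s.Nonempty ∧ P = convexHull ℝ (s : Set (L → ℝ))) ∧ P ⊆ N.rateRegion

theorem isRatePolytope_singleton {R : L → ℝ} (hR : R ∈ N.rateRegion) : IsRatePolytope N {R} :=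
  ⟨⟨{R}, Finset.singleton_nonempty R, by simp⟩, Set.singleton_subset_iff.2 hR⟩

variable [Fintype L] {k : ℕ} {C : Sessions V k}
  {obj : Objective k} {T : ℕ} {hT : 0 < T}

theorem IsIteration.exists_cycleRate {P : Set (L → ℝ)} {v : ℝ} {μ R' : L → ℝ}
    (h : IsIteration N C obj hT P v μ R') :
    ∃ m c, IsMaxMeanCycle (N.schedulingGraph T) (N.weight T μ) m c ∧ cycleRate m c = R' := by
  obtain ⟨m, c, hc, hR⟩ := h.rate
  exact ⟨m, c, hc, (isRateVector_periodicSchedule hT hc.1.pos c).unique hR⟩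

theorem IsIteration.sum_mul_le {P : Set (L → ℝ)} {v : ℝ} {μ R' : L → ℝ}
    (h : IsIteration N C obj hT P v μ R') {R : L → ℝ} (hR : R ∈ N.rateRegion) :
    ∑ l, μ l * R l ≤ ∑ l, μ l * R' l := by
  obtain ⟨m, c, hc, rfl⟩ := h.exists_cycleRate
  exact hc.sum_mul_le hT h.dual.nonneg hR

theorem IsRatePolytope.next
    (hdelay : ∀ l, ∀ l' ∈ N.collision l, |N.delay l l'| ≤ (T : ℤ)) {P : Set (L → ℝ)}
    (hP : IsRatePolytope N P) {v : ℝ} {μ R' : L → ℝ} (h : IsIteration N C obj hT P v μ R') :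
    IsRatePolytope N (convexHull ℝ (P ∪ {R'})) := by
  classical
  obtain ⟨⟨s, hs, rfl⟩, hsub⟩ := hP
  refine ⟨⟨insert R' s, Finset.insert_nonempty _ _, ?_⟩, ?_⟩
  · rw [convexHull_convexHull_union_left, Finset.coe_insert, Set.union_singleton]
  · refine convexHull_min (Set.union_subset hsub (Set.singleton_subset_iff.2 ?_))
      (convex_rateRegion hT hdelay)
    obtain ⟨m, c, hc, rfl⟩ := h.exists_cycleRate
    exact cycleRate_mem_rateRegion hT hdelay hc.1

/-- Every iteration can be carried out. -/
theorem IsRatePolytope.exists_isIteration (hobj : obj.WellPosed) (hT : 0 < T)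
    {P : Set (L → ℝ)} (hP : IsRatePolytope N P) :
    ∃ v μ R', IsIteration N C obj hT P v μ R' := by
  obtain ⟨⟨s, hs, rfl⟩, hsub⟩ := hP
  obtain ⟨v, hv⟩ := exists_isGreatest_lpValues (N := N) (C := C) hobj
    (s.finite_toSet.isCompact_convexHull (𝕜 := ℝ)) (convexHull_nonempty_iff.2 hs) fun R hR => (hsub hR).1
  obtain ⟨μ, hμ⟩ := exists_isDualVector hobj s hv
  obtain ⟨m, c, hc⟩ := exists_isMaxMeanCycle (w := N.weight T μ)
    (exists_isCycle_schedulingGraph N T)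
  exact ⟨v, μ, cycleRate m c, hv, hμ, m, c, hc, isRateVector_periodicSchedule hT hc.1.pos c⟩

theorem IsRatePolytope.of_reflTransGen
    (hdelay : ∀ l, ∀ l' ∈ N.collision l, |N.delay l l'| ≤ (T : ℤ)) {R₁ : L → ℝ}
    (hR₁ : R₁ ∈ N.rateRegion) {σ : State L}
    (h : Relation.ReflTransGen (Step N C obj hT) (State.running {R₁}) σ) :
    ∀ P, σ = State.running P → IsRatePolytope N P := by
  induction h with
  | refl =>
    rintro P ⟨⟩
    exact isRatePolytope_singleton hR₁
  | tail _ hstep ih =>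
    rintro P rfl
    cases hstep with
    | next P v μ R' hit _ => exact (ih P rfl).next hdelay hit

/-- An iteration that does not stop finds a new rate vector. -/
theorem IsIteration.notMem {P : Set (L → ℝ)} (hP : P ⊆ N.rateRegion) {v : ℝ} {μ R' : L → ℝ}
    (h : IsIteration N C obj hT P v μ R') (htest : ¬ StopTest P μ R') : R' ∉ P := fun hR' =>
  htest ⟨⟨R', hR', rfl⟩, by
    rintro _ ⟨R, hR, rfl⟩
    exact h.sum_mul_le (hP hR)⟩

/-- The stopping test certifies optimality over the whole rate region. -/
theorem IsIteration.isGreatest_of_stopTest {P : Set (L → ℝ)} (hP : P ⊆ N.rateRegion) {v : ℝ}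
    {μ R' : L → ℝ} (h : IsIteration N C obj hT P v μ R') (htest : StopTest P μ R') :
    IsGreatest (lpValues N C obj N.rateRegion) v := by
  obtain ⟨⟨R₀, hR₀, heq⟩, -⟩ := htest
  exact h.dual.isGreatest h.value hP hR₀ fun R hR => (h.sum_mul_le hR).trans_eq heq.symm

/-- The number of cycle rate vectors outside the current polytope. -/
noncomputable def missingRates (N : Network V L) (T : ℕ) (P : Set (L → ℝ)) : ℕ :=
  ({R | ∃ m c, IsCycle (N.schedulingGraph T) m c ∧ cycleRate m c = R} \ P).ncard

/-- The failed test puts the new cycle rate outside `P`, and the next hull contains it; the count is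
of a finite set, so it drops strictly. -/
theorem IsIteration.missingRates_lt {P : Set (L → ℝ)} (hP : P ⊆ N.rateRegion) {v : ℝ}
    {μ R' : L → ℝ} (h : IsIteration N C obj hT P v μ R') (htest : ¬ StopTest P μ R') :
    missingRates N T (convexHull ℝ (P ∪ {R'})) < missingRates N T P := by
  have hsub := subset_convexHull ℝ (P ∪ {R'})
  refine Set.ncard_lt_ncard ⟨Set.sdiff_subset_sdiff_right
    (Set.subset_union_left.trans hsub), fun hle => ?_⟩ ((finite_cycleRates N T).subset
      Set.sdiff_subset)
  obtain ⟨m, c, hc, rfl⟩ := h.exists_cycleRate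
  exact (hle ⟨⟨m, c, hc.1, rfl⟩, h.notMem hP htest⟩).2 (hsub (Or.inr rfl))

theorem not_exists_infinite_execution
    (hdelay : ∀ l, ∀ l' ∈ N.collision l, |N.delay l l'| ≤ (T : ℤ)) {R₁ : L → ℝ}
    (hR₁ : R₁ ∈ N.rateRegion) :
    ¬ ∃ σ : ℕ → State L, σ 0 = State.running {R₁} ∧
      ∀ n, Step N C obj hT (σ n) (σ (n + 1)) := by
  rintro ⟨σ, h₀, hσ⟩
  -- A returned state has no successor, so an infinite execution stays running and would make
  -- `missingRates` decrease forever.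
  have hrun : ∀ n, ∃ P, σ n = State.running P := fun n => by
    have := hσ n
    cases hn : σ n with
    | running P => exact ⟨P, rfl⟩
    | returned v =>
      rw [hn] at this
      cases this
  choose P hP using hrun
  have hreach : ∀ n, Relation.ReflTransGen (Step N C obj hT) (State.running {R₁}) (σ n) := fun n => by
    induction n with
    | zero => rw [h₀]
    | succ n ih => exact ih.tail (hσ n)
  have hlt : ∀ n, missingRates N T (P (n + 1)) < missingRates N T (P n) := fun n => by
    have hpoly := IsRatePolytope.of_reflTransGen hdelay hR₁ (hreach n) _ (hP n)
    have hstep := hσ n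
    rw [hP n, hP (n + 1)] at hstep
    generalize P (n + 1) = P' at hstep ⊢
    cases hstep with
    | next _ v μ R' hit htest => exact hit.missingRates_lt hpoly.2 htest
  exact not_strictAnti_of_wellFoundedLT _ (strictAnti_nat_of_succ_lt (f := fun n => missingRates N T (P n)) hlt)

end Optimality

end Multiflow

/-- For every start `R₁` in the rate region and every choice made by the subroutines: the
algorithm has no infinite execution, it never gets stuck before returning a value, and every
value it returns is the maximum (concurrent) multiflow over the whole scheduling rate region. -/
theorem mainTheorem3 {V L : Type*} [Finite V] [Fintype L] {k : ℕ} (N : Network V L)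
    (C : Sessions V k) (obj : Objective k) (hobj : obj.WellPosed)
    (T : ℕ) (hT : 0 < T) (hdelay : ∀ l, ∀ l' ∈ N.collision l, |N.delay l l'| ≤ (T : ℤ))
    (R₁ : L → ℝ) (hR₁ : R₁ ∈ N.rateRegion) :
    (¬ ∃ σ : ℕ → State L, σ 0 = State.running {R₁} ∧
      ∀ n, Step N C obj hT (σ n) (σ (n + 1))) ∧
    (∀ P : Set (L → ℝ),
      Relation.ReflTransGen (Step N C obj hT) (State.running {R₁}) (State.running P) →
        ∃ σ : State L, Step N C obj hT (State.running P) σ) ∧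
    (∀ v : ℝ,
      Relation.ReflTransGen (Step N C obj hT) (State.running {R₁}) (State.returned v) →
        IsGreatest (lpValues N C obj N.rateRegion) v) := by
  refine ⟨not_exists_infinite_execution hdelay hR₁, fun P hP => ?_, fun v hv => ?_⟩
  · obtain ⟨v, μ, R', hit⟩ :=
      (IsRatePolytope.of_reflTransGen hdelay hR₁ hP P rfl).exists_isIteration hobj hT
    by_cases htest : StopTest P μ R'
    · exact ⟨_, Step.finish P v μ R' hit htest⟩
    · exact ⟨_, Step.next P v μ R' hit htest⟩
  · obtain hv | ⟨σ, hσ, hstep⟩ := hv.cases_tail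
    · cases hv
    · cases hstep with
      | finish P v μ R' hit htest =>
        exact hit.isGreatest_of_stopTest
          (IsRatePolytope.of_reflTransGen hdelay hR₁ hσ P rfl).2 htest
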